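/- For $q\in\mathbb{C}$ with $|q|<1$, let $$a(q)=\sum_{m,n\in\mathbb{Z}} q^{m^2+mn+n^2}.$$ For a positive integer $n$ let $\sigma_1(n)$ denote the sum of the positive divisors of $n$, and put $\sigma_1(x)=0$ for every rational number $x$ that is not a positive integer (so $\sigma_1(n/3)=0$ when $3\nmid n$). Then, for every $q\in\mathbb{C}$ with $|q|<1$, both series below converge absolutely and $$a(q)^2=1+12\sum_{n=1}^{\infty}\bigl(\sigma_1(n)-3\sigma_1(n/3)\bigr)q^n .$$ -/

import Mathlib

/-- The term `q ^ (m² + m n + n²)` of the series `a(q)`; the exponent is a nonnegative integer. -/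
noncomputable def cubicThetaTerm (q : ℂ) (p : ℤ × ℤ) : ℂ :=
  q ^ (p.1 ^ 2 + p.1 * p.2 + p.2 ^ 2)

/-- The theta function `a(q) = ∑_{m, n ∈ ℤ} q ^ (m² + m n + n²)`. -/
noncomputable def cubicThetaA (q : ℂ) : ℂ :=
  ∑' p : ℤ × ℤ, cubicThetaTerm q p

/-- The divisor sum `σ_k(x)` at a rational argument: the sum of the `k`-th powers of the positive
divisors of `x` if `x` is a positive integer, and `0` for every other rational number `x`. -/
def sigmaRat (k : ℕ) (x : ℚ) : ℕ :=
  if x.den = 1 ∧ 0 < x.num then ∑ d ∈ Nat.divisors x.num.toNat, d ^ k else 0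

/-- The quadruples `((a, x), (b, y))` of positive integers with `a * x + b * y = n`. -/
def productPairs (n : ℕ) : Finset ((ℕ × ℕ) × (ℕ × ℕ)) :=
  (Finset.HasAntidiagonal.antidiagonal n).biUnion fun k => k.1.divisorsAntidiagonal ×ˢ k.2.divisorsAntidiagonal

theorem mem_productPairs {n a x b y : ℕ} :
    ((a, x), (b, y)) ∈ productPairs n ↔
      a * x + b * y = n ∧ 0 < a ∧ 0 < x ∧ 0 < b ∧ 0 < y := by
  simp only [productPairs, Finset.mem_biUnion, Finset.HasAntidiagonal.mem_antidiagonal, Finset.mem_product,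
    Nat.mem_divisorsAntidiagonal, Prod.exists]
  constructor
  · rintro ⟨k, l, h, ⟨rfl, hk⟩, rfl, hl⟩
    simp only [ne_eq, mul_eq_zero, not_or] at hk hl
    omega
  · rintro ⟨h, ha, hx, hb, hy⟩
    exact ⟨a * x, b * y, h, ⟨rfl, (Nat.mul_pos ha hx).ne'⟩, rfl, (Nat.mul_pos hb hy).ne'⟩

theorem sum_productPairs {M : Type*} [AddCommMonoid M] (n : ℕ)
    (F : (ℕ × ℕ) × (ℕ × ℕ) → M) :
    ∑ t ∈ productPairs n, F t = ∑ k ∈ Finset.HasAntidiagonal.antidiagonal n,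
      ∑ u ∈ k.1.divisorsAntidiagonal, ∑ v ∈ k.2.divisorsAntidiagonal, F (u, v) := by
  rw [productPairs, Finset.sum_biUnion]
  · exact Finset.sum_congr rfl fun k _ => Finset.sum_product _ _ _
  · rintro ⟨k, l⟩ - ⟨k', l'⟩ - hne
    rw [Function.onFun, Finset.disjoint_left]
    rintro ⟨⟨a, x⟩, ⟨b, y⟩⟩ h h'
    simp only [Finset.mem_product, Nat.mem_divisorsAntidiagonal] at h h'
    exact hne (Prod.ext (h.1.1.symm.trans h'.1.1) (h.2.1.symm.trans h'.2.1))

theorem sum_productPairs_swap {M : Type*} [AddCommMonoid M] (n : ℕ)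
    (P Q : (ℕ × ℕ) × (ℕ × ℕ) → Prop) [DecidablePred P] [DecidablePred Q]
    (F G : (ℕ × ℕ) × (ℕ × ℕ) → M)
    (hPQ : ∀ t, P t ↔ Q t.swap) (hFG : ∀ t, F t = G t.swap) :
    ∑ t ∈ productPairs n with P t, F t = ∑ t ∈ productPairs n with Q t, G t := by
  refine Finset.sum_nbij' Prod.swap Prod.swap ?_ ?_ (by simp) (by simp) fun t _ => hFG t
  · rintro ⟨⟨a, x⟩, ⟨b, y⟩⟩ h
    simp only [Finset.mem_filter, Prod.swap_prod_mk, mem_productPairs, hPQ] at h ⊢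
    exact ⟨by omega, h.2⟩
  · rintro ⟨⟨a, x⟩, ⟨b, y⟩⟩ h
    simp only [Finset.mem_filter, Prod.swap_prod_mk, mem_productPairs, hPQ] at h ⊢
    exact ⟨by omega, h.2⟩

/-- A Euclidean step: `a x + b y = (a - b) x + b (x + y)`, reversible because the new second
cofactor exceeds the first. -/
theorem sum_productPairs_sub {M : Type*} [AddCommMonoid M] (n : ℕ) (f : ℕ → M) :
    ∑ t ∈ productPairs n with t.2.1 < t.1.1, f (t.1.1 - t.2.1) =
      ∑ t ∈ productPairs n with t.1.2 < t.2.2, f t.1.1 := by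
  refine Finset.sum_nbij' (fun t => ((t.1.1 - t.2.1, t.1.2), (t.2.1, t.1.2 + t.2.2)))
    (fun t => ((t.1.1 + t.2.1, t.1.2), (t.2.1, t.2.2 - t.1.2))) ?_ ?_ ?_ ?_ fun _ _ => rfl
  · rintro ⟨⟨a, x⟩, ⟨b, y⟩⟩ h
    simp only [Finset.mem_filter, mem_productPairs] at h ⊢
    obtain ⟨c, rfl⟩ := Nat.exists_eq_add_of_lt h.2
    refine ⟨⟨?_, ?_⟩, ?_⟩
    · rw [← h.1.1, show b + c + 1 - b = c + 1 by omega]; ring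
    all_goals omega
  · rintro ⟨⟨a, x⟩, ⟨b, y⟩⟩ h
    simp only [Finset.mem_filter, mem_productPairs] at h ⊢
    obtain ⟨c, rfl⟩ := Nat.exists_eq_add_of_lt h.2
    refine ⟨⟨?_, ?_⟩, ?_⟩
    · rw [← h.1.1, show x + c + 1 - x = c + 1 by omega]; ring
    all_goals omega
  · rintro ⟨⟨a, x⟩, ⟨b, y⟩⟩ h
    simp only [Finset.mem_filter, Prod.mk.injEq, and_true, true_and] at h ⊢
    omega
  · rintro ⟨⟨a, x⟩, ⟨b, y⟩⟩ h
    simp only [Finset.mem_filter, Prod.mk.injEq, and_true, true_and] at h ⊢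
    omega

/-- Regrouping `a x + b y = (a + b) y + a (x - y)`. -/
theorem sum_productPairs_add {M : Type*} [AddCommMonoid M] (n : ℕ) (f : ℕ → M) :
    ∑ t ∈ productPairs n with t.2.2 < t.1.2, f (t.1.1 + t.2.1) =
      ∑ t ∈ productPairs n with t.2.1 < t.1.1, f t.1.1 := by
  refine Finset.sum_nbij' (fun t => ((t.1.1 + t.2.1, t.2.2), (t.1.1, t.1.2 - t.2.2)))
    (fun t => ((t.2.1, t.1.2 + t.2.2), (t.1.1 - t.2.1, t.1.2))) ?_ ?_ ?_ ?_ fun _ _ => rfl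
  · rintro ⟨⟨a, x⟩, ⟨b, y⟩⟩ h
    simp only [Finset.mem_filter, mem_productPairs] at h ⊢
    obtain ⟨c, rfl⟩ := Nat.exists_eq_add_of_lt h.2
    refine ⟨⟨?_, ?_⟩, ?_⟩
    · rw [← h.1.1, show y + c + 1 - y = c + 1 by omega]; ring
    all_goals omega
  · rintro ⟨⟨a, x⟩, ⟨b, y⟩⟩ h
    simp only [Finset.mem_filter, mem_productPairs] at h ⊢
    obtain ⟨c, rfl⟩ := Nat.exists_eq_add_of_lt h.2
    refine ⟨⟨?_, ?_⟩, ?_⟩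
    · rw [← h.1.1, show b + c + 1 - b = c + 1 by omega]; ring
    all_goals omega
  · rintro ⟨⟨a, x⟩, ⟨b, y⟩⟩ h
    simp only [Finset.mem_filter, Prod.mk.injEq, and_true, true_and] at h ⊢
    omega
  · rintro ⟨⟨a, x⟩, ⟨b, y⟩⟩ h
    simp only [Finset.mem_filter, Prod.mk.injEq, and_true, true_and] at h ⊢
    omega

/-- The same regrouping with the two products in the other order, so that `a` stays in first place.
-/
theorem sum_productPairs_fst {M : Type*} [AddCommMonoid M] (n : ℕ) (f : ℕ → M) :
    ∑ t ∈ productPairs n with t.2.2 < t.1.2, f t.1.1 =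
      ∑ t ∈ productPairs n with t.1.1 < t.2.1, f t.1.1 := by
  refine Finset.sum_nbij' (fun t => ((t.1.1, t.1.2 - t.2.2), (t.1.1 + t.2.1, t.2.2)))
    (fun t => ((t.1.1, t.1.2 + t.2.2), (t.2.1 - t.1.1, t.2.2))) ?_ ?_ ?_ ?_ fun _ _ => rfl
  · rintro ⟨⟨a, x⟩, ⟨b, y⟩⟩ h
    simp only [Finset.mem_filter, mem_productPairs] at h ⊢
    obtain ⟨c, rfl⟩ := Nat.exists_eq_add_of_lt h.2
    refine ⟨⟨?_, ?_⟩, ?_⟩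
    · rw [← h.1.1, show y + c + 1 - y = c + 1 by omega]; ring
    all_goals omega
  · rintro ⟨⟨a, x⟩, ⟨b, y⟩⟩ h
    simp only [Finset.mem_filter, mem_productPairs] at h ⊢
    obtain ⟨c, rfl⟩ := Nat.exists_eq_add_of_lt h.2
    refine ⟨⟨?_, ?_⟩, ?_⟩
    · rw [← h.1.1, show a + c + 1 - a = c + 1 by omega]; ring
    all_goals omega
  · rintro ⟨⟨a, x⟩, ⟨b, y⟩⟩ h
    simp only [Finset.mem_filter, Prod.mk.injEq, and_true, true_and] at h ⊢
    omega
  · rintro ⟨⟨a, x⟩, ⟨b, y⟩⟩ h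
    simp only [Finset.mem_filter, Prod.mk.injEq, and_true, true_and] at h ⊢
    omega

/-- On the diagonal `x = y` the equation becomes `(a + b) x = n`, so `d = a + b` is a divisor of
`n`. -/
theorem sum_productPairs_snd_eq {M : Type*} [AddCommMonoid M] (n : ℕ) (F : ℕ → ℕ → M) :
    ∑ t ∈ productPairs n with t.1.2 = t.2.2, F t.1.1 t.2.1 =
      ∑ d ∈ n.divisors, ∑ a ∈ Finset.Ico 1 d, F a (d - a) := by
  rw [Finset.sum_sigma']
  refine Finset.sum_nbij' (fun t => ⟨t.1.1 + t.2.1, t.1.1⟩)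
    (fun s => ((s.2, n / s.1), (s.1 - s.2, n / s.1))) ?_ ?_ ?_ ?_ ?_
  · rintro ⟨⟨a, x⟩, ⟨b, y⟩⟩ h
    simp only [Finset.mem_filter, mem_productPairs, Finset.mem_sigma, Nat.mem_divisors,
      Finset.mem_Ico] at h ⊢
    obtain ⟨⟨rfl, ha, hx, hb, hy⟩, rfl⟩ := h
    exact ⟨⟨⟨x, by ring⟩, by positivity⟩, by omega⟩
  · rintro ⟨d, a⟩ h
    simp only [Finset.mem_filter, mem_productPairs, Finset.mem_sigma, Nat.mem_divisors,
      Finset.mem_Ico] at h ⊢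
    obtain ⟨⟨⟨x, rfl⟩, hn⟩, h1, h2⟩ := h
    have hx : 0 < x := Nat.pos_of_ne_zero (by rintro rfl; simp at hn)
    rw [Nat.mul_div_cancel_left _ (by omega)]
    refine ⟨⟨?_, by omega⟩, trivial⟩
    rw [← add_mul, Nat.add_sub_cancel' h2.le]
  · rintro ⟨⟨a, x⟩, ⟨b, y⟩⟩ h
    simp only [Finset.mem_filter, mem_productPairs] at h ⊢
    obtain ⟨⟨rfl, ha, hx, hb, hy⟩, rfl⟩ := h
    rw [← add_mul, Nat.mul_div_cancel_left _ (by omega), Nat.add_sub_cancel_left]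
  · rintro ⟨d, a⟩ h
    simp only [Finset.mem_sigma, Finset.mem_Ico] at h ⊢
    rw [Nat.add_sub_cancel' h.2.2.le]
  · rintro ⟨⟨a, x⟩, ⟨b, y⟩⟩ -
    simp

theorem sum_productPairs_fst_eq (n : ℕ) (f : ℕ → ℤ) :
    ∑ t ∈ productPairs n with t.1.1 = t.2.1, f t.1.1 =
      ∑ d ∈ n.divisors, ((n / d : ℕ) - 1 : ℤ) * f d := by
  have key : ∑ t ∈ productPairs n with t.1.1 = t.2.1, f t.1.1 =
      ∑ d ∈ n.divisors, ∑ x ∈ Finset.Ico 1 (n / d), f d := by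
    rw [Finset.sum_sigma']
    refine Finset.sum_nbij' (fun t => ⟨t.1.1, t.1.2⟩)
      (fun s => ((s.1, s.2), (s.1, n / s.1 - s.2))) ?_ ?_ ?_ ?_ ?_
    · rintro ⟨⟨a, x⟩, ⟨b, y⟩⟩ h
      simp only [Finset.mem_filter, mem_productPairs, Finset.mem_sigma, Nat.mem_divisors,
        Finset.mem_Ico] at h ⊢
      obtain ⟨⟨rfl, ha, hx, hb, hy⟩, rfl⟩ := h
      rw [← mul_add, Nat.mul_div_cancel_left _ ha]
      exact ⟨⟨Dvd.intro _ rfl, by positivity⟩, by omega⟩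
    · rintro ⟨a, x⟩ h
      simp only [Finset.mem_filter, mem_productPairs, Finset.mem_sigma, Nat.mem_divisors,
        Finset.mem_Ico] at h ⊢
      obtain ⟨⟨⟨z, rfl⟩, hn⟩, h1, h2⟩ := h
      have ha : 0 < a := Nat.pos_of_ne_zero (by rintro rfl; simp at hn)
      rw [Nat.mul_div_cancel_left _ ha] at h2 ⊢
      refine ⟨⟨?_, by omega⟩, trivial⟩
      rw [← mul_add, Nat.add_sub_cancel' h2.le]
    · rintro ⟨⟨a, x⟩, ⟨b, y⟩⟩ h
      simp only [Finset.mem_filter, mem_productPairs] at h ⊢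
      obtain ⟨⟨rfl, ha, hx, hb, hy⟩, rfl⟩ := h
      rw [← mul_add, Nat.mul_div_cancel_left _ ha, Nat.add_sub_cancel_left]
    · rintro ⟨d, a⟩ h
      rfl
    · rintro ⟨⟨a, x⟩, ⟨b, y⟩⟩ -
      rfl
  rw [key]
  refine Finset.sum_congr rfl fun d hd => ?_
  rw [Finset.sum_const, Nat.card_Ico, nsmul_eq_mul, Nat.cast_sub, Nat.cast_one]
  exact Nat.div_pos (Nat.divisor_le hd) (Nat.pos_of_mem_divisors hd)

theorem Finset.sum_trichotomy {ι M : Type*} [AddCommMonoid M] (s : Finset ι) (u v : ι → ℕ)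
    (F : ι → M) :
    ∑ t ∈ s, F t = ∑ t ∈ s with u t = v t, F t + ∑ t ∈ s with v t < u t, F t +
      ∑ t ∈ s with u t < v t, F t := by
  simp only [Finset.sum_filter]
  rw [← Finset.sum_add_distrib, ← Finset.sum_add_distrib]
  refine Finset.sum_congr rfl fun t _ => ?_
  rcases lt_trichotomy (u t) (v t) with h | h | h
  · simp [h, h.ne, h.not_gt]
  · simp [h]
  · simp [h, h.ne', h.not_gt]

/-- A Liouville type identity of Huard, Ou, Spearman and Williams. -/
theorem sum_productPairs_dist_sub_add (n : ℕ) (f : ℕ → ℤ) :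
    ∑ t ∈ productPairs n, (f (Nat.dist t.1.1 t.2.1) - f (t.1.1 + t.2.1)) =
      ∑ d ∈ n.divisors, (((n / d : ℕ) - 1 : ℤ) * f 0 + (2 * (n / d : ℕ) - d - 1 : ℤ) * f d -
        2 * ∑ a ∈ Finset.Ico 1 d, f a) := by
  have h1 : ∑ t ∈ productPairs n with t.1.1 = t.2.1, f (Nat.dist t.1.1 t.2.1) =
      ∑ d ∈ n.divisors, ((n / d : ℕ) - 1 : ℤ) * f 0 := by
    rw [← sum_productPairs_fst_eq n fun _ => f 0]
    refine Finset.sum_congr rfl fun t ht => ?_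
    rw [(Finset.mem_filter.1 ht).2, Nat.dist_self]
  have h2 : ∑ t ∈ productPairs n with t.2.1 < t.1.1, f (Nat.dist t.1.1 t.2.1) =
      ∑ t ∈ productPairs n with t.1.2 < t.2.2, f t.1.1 := by
    rw [← sum_productPairs_sub]
    refine Finset.sum_congr rfl fun t ht => ?_
    rw [Nat.dist_eq_sub_of_le_right (Finset.mem_filter.1 ht).2.le]
  have h3 : ∑ t ∈ productPairs n with t.1.1 < t.2.1, f (Nat.dist t.1.1 t.2.1) =
      ∑ t ∈ productPairs n with t.2.1 < t.1.1, f (Nat.dist t.1.1 t.2.1) :=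
    sum_productPairs_swap _ _ _ _ _ (fun _ => Iff.rfl) fun t => by simp [Nat.dist_comm]
  have h4 : ∑ t ∈ productPairs n with t.1.2 < t.2.2, f (t.1.1 + t.2.1) =
      ∑ t ∈ productPairs n with t.2.2 < t.1.2, f (t.1.1 + t.2.1) :=
    sum_productPairs_swap _ _ _ _ _ (fun _ => Iff.rfl) fun t => by simp [add_comm]
  have h5 : ∑ t ∈ productPairs n with t.1.2 = t.2.2, f (t.1.1 + t.2.1) =
      ∑ d ∈ n.divisors, (d - 1 : ℤ) * f d := by
    rw [sum_productPairs_snd_eq n fun a b => f (a + b)]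
    refine Finset.sum_congr rfl fun d hd => ?_
    rw [Finset.sum_congr rfl fun a ha => by
      rw [Nat.add_sub_cancel' (Finset.mem_Ico.1 ha).2.le], Finset.sum_const, Nat.card_Ico,
      nsmul_eq_mul, Nat.cast_sub (Nat.pos_of_mem_divisors hd), Nat.cast_one]
  have h6 := sum_productPairs_add n f
  have h7 := sum_productPairs_fst n f
  have h8 := sum_productPairs_snd_eq n fun a _ => f a
  have h9 := sum_productPairs_fst_eq n f
  -- Neither the full sum of `f a` nor its part over `a < b` is known, but both cancel: by `h7`,
  -- `t3` and `t4`, the part over `x < y` minus the part over `a > b` equals the diagonal `a = b`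
  -- minus the diagonal `x = y`.
  have t1 := Finset.sum_trichotomy (productPairs n) (fun t => t.1.1) (fun t => t.2.1)
    fun t => f (Nat.dist t.1.1 t.2.1)
  have t2 := Finset.sum_trichotomy (productPairs n) (fun t => t.1.2) (fun t => t.2.2)
    fun t => f (t.1.1 + t.2.1)
  have t3 := Finset.sum_trichotomy (productPairs n) (fun t => t.1.1) (fun t => t.2.1)
    fun t => f t.1.1
  have t4 := Finset.sum_trichotomy (productPairs n) (fun t => t.1.2) (fun t => t.2.2)
    fun t => f t.1.1
  have e : ∑ d ∈ n.divisors, (((n / d : ℕ) - 1 : ℤ) * f 0 + (2 * (n / d : ℕ) - d - 1 : ℤ) * f d -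
        2 * ∑ a ∈ Finset.Ico 1 d, f a) =
      ∑ d ∈ n.divisors, ((n / d : ℕ) - 1 : ℤ) * f 0 +
      2 * ∑ d ∈ n.divisors, ((n / d : ℕ) - 1 : ℤ) * f d - ∑ d ∈ n.divisors, (d - 1 : ℤ) * f d -
      2 * ∑ d ∈ n.divisors, ∑ a ∈ Finset.Ico 1 d, f a + 0 := by
    rw [Finset.mul_sum, Finset.mul_sum, ← Finset.sum_add_distrib, ← Finset.sum_sub_distrib,
      ← Finset.sum_sub_distrib, add_zero]
    exact Finset.sum_congr rfl fun d _ => by ring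
  rw [Finset.sum_sub_distrib, e]
  linarith

/-! ### The convolution square of the character divisor sum -/

/-- The nontrivial Dirichlet character modulo `3`. -/
def chiThree (n : ℕ) : ℤ := if n % 3 = 1 then 1 else if n % 3 = 2 then -1 else 0

/-- The divisor sum `∑_{d ∣ n} χ(d)` of the nontrivial character modulo `3`. -/
def divisorSumChiThree (n : ℕ) : ℤ := ∑ d ∈ n.divisors, chiThree d

/-- Counts multiples of 3 below `d`; the character is the correction for the residue of `d`, and
produces the term `-r(n)` in the convolution formula. -/
theorem sum_Ico_three_dvd (d : ℕ) (hd : 0 < d) :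
    6 * ∑ a ∈ Finset.Ico 1 d, (if 3 ∣ a then 1 else 0 : ℤ) =
      2 * d - 3 + chiThree d - 3 * (if 3 ∣ d then 1 else 0) := by
  induction d, hd using Nat.le_induction with
  | base => simp [chiThree]
  | succ d hd ih =>
    rw [Finset.sum_Ico_succ_top hd, mul_add, ih]
    have h : d % 3 = 0 ∨ d % 3 = 1 ∨ d % 3 = 2 := by omega
    have h' : (d + 1) % 3 = (d % 3 + 1) % 3 := by omega
    simp only [chiThree, Nat.dvd_iff_mod_eq_zero, h']
    rcases h with h | h | h <;> simp [h] <;> ring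

theorem sum_divisors_three_dvd (n : ℕ) (F : ℕ → ℤ) :
    ∑ d ∈ n.divisors, (if 3 ∣ d then F d else 0) =
      if 3 ∣ n then ∑ d ∈ (n / 3).divisors, F (3 * d) else 0 := by
  split_ifs with h
  · obtain ⟨m, rfl⟩ := h
    rw [Nat.mul_div_cancel_left _ (by norm_num), ← Finset.sum_filter]
    symm
    refine Finset.sum_nbij' (fun d => 3 * d) (fun d => d / 3) ?_ ?_ ?_ ?_ fun _ _ => rfl
    · intro d hd
      simp only [Nat.mem_divisors, Finset.mem_filter] at hd ⊢
      exact ⟨⟨Nat.mul_dvd_mul_left 3 hd.1, by omega⟩, Dvd.intro _ rfl⟩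
    · intro d hd
      simp only [Nat.mem_divisors, Finset.mem_filter] at hd ⊢
      obtain ⟨⟨h1, h2⟩, e, rfl⟩ := hd
      rw [Nat.mul_div_cancel_left _ (by norm_num)]
      exact ⟨Nat.dvd_of_mul_dvd_mul_left (by norm_num) h1, by omega⟩
    · intro d _
      simp
    · intro d hd
      exact Nat.mul_div_cancel' (Finset.mem_filter.1 hd).2
  · refine Finset.sum_eq_zero fun d hd => if_neg fun h3 => h (h3.trans (Nat.dvd_of_mem_divisors hd))

/-- The divisor sum `σ₁(n / 3)`, which is `0` unless `3 ∣ n`. -/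
def sigmaThird (n : ℕ) : ℤ := if 3 ∣ n then ∑ d ∈ (n / 3).divisors, (d : ℤ) else 0

theorem sum_antidiagonal_divisorSumChiThree (n : ℕ) :
    3 * ∑ k ∈ Finset.HasAntidiagonal.antidiagonal n, divisorSumChiThree k.1 * divisorSumChiThree k.2 =
      ∑ d ∈ n.divisors, (d : ℤ) - 3 * sigmaThird n - divisorSumChiThree n := by
  -- Here `χ(a) χ(b) = [3 ∣ a - b] - [3 ∣ a + b]`, checked on residues.
  have h1 : ∑ k ∈ Finset.HasAntidiagonal.antidiagonal n, divisorSumChiThree k.1 * divisorSumChiThree k.2 =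
      ∑ t ∈ productPairs n, ((if 3 ∣ Nat.dist t.1.1 t.2.1 then 1 else 0) -
        (if 3 ∣ t.1.1 + t.2.1 then 1 else 0) : ℤ) := by
    rw [sum_productPairs]
    refine Finset.sum_congr rfl fun k _ => ?_
    rw [divisorSumChiThree, divisorSumChiThree, ← Nat.sum_divisorsAntidiagonal (fun d _ => chiThree d),
      ← Nat.sum_divisorsAntidiagonal (fun d _ => chiThree d), Finset.sum_mul_sum]
    refine Finset.sum_congr rfl fun u _ => Finset.sum_congr rfl fun v _ => ?_
    have hu : u.1 % 3 = 0 ∨ u.1 % 3 = 1 ∨ u.1 % 3 = 2 := by omega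
    have hv : v.1 % 3 = 0 ∨ v.1 % 3 = 1 ∨ v.1 % 3 = 2 := by omega
    have e1 : 3 ∣ Nat.dist u.1 v.1 ↔ u.1 % 3 = v.1 % 3 := by unfold Nat.dist; omega
    have e2 : 3 ∣ u.1 + v.1 ↔ (u.1 % 3 + v.1 % 3) % 3 = 0 := by omega
    simp only [e1, e2, chiThree]
    rcases hu with hu | hu | hu <;> rcases hv with hv | hv | hv <;> simp [hu, hv]
  have h2 := sum_productPairs_dist_sub_add n fun a => if 3 ∣ a then 1 else 0
  have h3 : ∑ d ∈ n.divisors, (if 3 ∣ d then (d : ℤ) else 0) = 3 * sigmaThird n := by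
    rw [sum_divisors_three_dvd, sigmaThird, mul_ite, Finset.mul_sum]
    simp
  have h4 : ∑ d ∈ n.divisors, (if 3 ∣ d then ((n / d : ℕ) : ℤ) else 0) = sigmaThird n := by
    rw [sum_divisors_three_dvd n fun d => ((n / d : ℕ) : ℤ), sigmaThird]
    simp only [← Nat.div_div_eq_div_mul]
    split_ifs
    · exact Nat.sum_div_divisors (n / 3) fun d => (d : ℤ)
    · rfl
  have h5 : ∑ d ∈ n.divisors, ((n / d : ℕ) : ℤ) = ∑ d ∈ n.divisors, (d : ℤ) :=
    Nat.sum_div_divisors n fun d => (d : ℤ)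
  rw [h1, h2, Finset.mul_sum]
  have h6 : ∀ d ∈ n.divisors, (3 * (((n / d : ℕ) - 1 : ℤ) * (if 3 ∣ 0 then 1 else 0) +
      (2 * (n / d : ℕ) - d - 1 : ℤ) * (if 3 ∣ d then 1 else 0) -
        2 * ∑ a ∈ Finset.Ico 1 d, (if 3 ∣ a then 1 else 0)) : ℤ) =
      3 * (n / d : ℕ) + 6 * (if 3 ∣ d then ((n / d : ℕ) : ℤ) else 0) -
        3 * (if 3 ∣ d then (d : ℤ) else 0) - 2 * d - chiThree d := by
    intro d hd
    have := sum_Ico_three_dvd d (Nat.pos_of_mem_divisors hd)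
    rw [if_pos (dvd_zero 3)]
    split_ifs at this ⊢ <;> linarith
  rw [Finset.sum_congr rfl h6]
  simp only [Finset.sum_sub_distrib, Finset.sum_add_distrib, ← Finset.mul_sum, h3, h4, h5]
  rw [divisorSumChiThree]
  ring

/-! ### Eisenstein integers: representations of `p n` for `p` prime -/

/-- The norm form `x² + x y + y²` of the Eisenstein integers. -/
def eisensteinForm (z : ℤ × ℤ) : ℤ := z.1 ^ 2 + z.1 * z.2 + z.2 ^ 2

/-- Multiplication in `ℤ[ω]`, in coordinates `x + y ω`, where `ω² = ω - 1`. -/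
def eisensteinMul (w z : ℤ × ℤ) : ℤ × ℤ :=
  (w.1 * z.1 - w.2 * z.2, w.1 * z.2 + w.2 * z.1 + w.2 * z.2)

/-- Conjugation in `ℤ[ω]`, in coordinates `x + y ω`. -/
def eisensteinConj (z : ℤ × ℤ) : ℤ × ℤ := (z.1 + z.2, -z.2)

theorem eisensteinForm_mul (w z : ℤ × ℤ) :
    eisensteinForm (eisensteinMul w z) = eisensteinForm w * eisensteinForm z := by
  simp only [eisensteinForm, eisensteinMul]; ring

theorem eisensteinForm_conj (z : ℤ × ℤ) :
    eisensteinForm (eisensteinConj z) = eisensteinForm z := by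
  simp only [eisensteinForm, eisensteinConj]; ring

theorem eisensteinMul_conj_mul (w z : ℤ × ℤ) :
    eisensteinMul w (eisensteinMul (eisensteinConj w) z) =
      (eisensteinForm w * z.1, eisensteinForm w * z.2) := by
  simp only [eisensteinForm, eisensteinMul, eisensteinConj, Prod.mk.injEq]
  constructor <;> ring

theorem eisensteinMul_mul_conj (w z : ℤ × ℤ) :
    eisensteinMul (eisensteinConj w) (eisensteinMul w z) =
      (eisensteinForm w * z.1, eisensteinForm w * z.2) := by
  simp only [eisensteinForm, eisensteinMul, eisensteinConj, Prod.mk.injEq]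
  constructor <;> ring

theorem eisensteinForm_scalar (c : ℤ) (z : ℤ × ℤ) :
    eisensteinForm (c * z.1, c * z.2) = c ^ 2 * eisensteinForm z := by
  simp only [eisensteinForm]; ring

theorem four_mul_eisensteinForm (z : ℤ × ℤ) :
    4 * eisensteinForm z = (2 * z.1 + z.2) ^ 2 + 3 * z.2 ^ 2 := by
  simp only [eisensteinForm]; ring

theorem eisensteinMul_injective {w : ℤ × ℤ} (hw : eisensteinForm w ≠ 0) :
    Function.Injective (eisensteinMul w) := by
  intro z z' h
  have := congrArg (eisensteinMul (eisensteinConj w)) h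
  rw [eisensteinMul_mul_conj, eisensteinMul_mul_conj, Prod.mk.injEq] at this
  exact Prod.ext (mul_left_cancel₀ hw this.1) (mul_left_cancel₀ hw this.2)

theorem eisensteinForm_nonneg (z : ℤ × ℤ) : 0 ≤ eisensteinForm z := by
  nlinarith [four_mul_eisensteinForm z, sq_nonneg (2 * z.1 + z.2), sq_nonneg z.2]

theorem eisensteinForm_eq_zero {z : ℤ × ℤ} : eisensteinForm z = 0 ↔ z = 0 := by
  refine ⟨fun h => ?_, fun h => by simp [h, eisensteinForm]⟩
  have h4 := four_mul_eisensteinForm z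
  have h2 : z.2 ^ 2 = 0 := by nlinarith [sq_nonneg (2 * z.1 + z.2), sq_nonneg z.2]
  have h2' : z.2 = 0 := by simpa using h2
  have h1 : z.1 = 0 := by simpa [eisensteinForm, h2'] using h
  exact Prod.ext h1 h2'

theorem finite_eisensteinForm_le (n : ℤ) : {z | eisensteinForm z ≤ n}.Finite := by
  refine ((Set.finite_Icc (-2 * n) (2 * n)).prod (Set.finite_Icc (-2 * n) (2 * n))).subset ?_
  rintro ⟨x, y⟩ h
  simp only [eisensteinForm, Set.mem_ofPred_eq, Set.mem_prod, Set.mem_Icc] at h ⊢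
  have hx : x ^ 2 ≤ 2 * n := by nlinarith [sq_nonneg (x + 2 * y)]
  have hy : y ^ 2 ≤ 2 * n := by nlinarith [sq_nonneg (2 * x + y)]
  have hx' : |x| ≤ x ^ 2 := by rw [← sq_abs]; exact Int.le_self_sq _
  have hy' : |y| ≤ y ^ 2 := by rw [← sq_abs]; exact Int.le_self_sq _
  have := abs_le.1 (hx'.trans hx)
  have := abs_le.1 (hy'.trans hy)
  omega

/-- The representations of `n` by the form `x² + x y + y²`. -/
def eisensteinReps (n : ℤ) : Set (ℤ × ℤ) := {z | eisensteinForm z = n}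

theorem finite_eisensteinReps (n : ℤ) : (eisensteinReps n).Finite :=
  (finite_eisensteinForm_le n).subset fun _ h => le_of_eq h

/-- The norm of `w̄ z` is `p² n`, so once `p` divides its second coordinate it divides the first.
Writing `w̄ z = p v` and multiplying by `w` gives `z = w v`. -/
theorem mem_image_eisensteinMul {p n : ℤ} (hp : Prime p) {w z : ℤ × ℤ}
    (hw : eisensteinForm w = p) (hz : eisensteinForm z = p * n)
    (h : p ∣ (eisensteinMul (eisensteinConj w) z).2) :
    z ∈ eisensteinMul w '' eisensteinReps n := by
  obtain ⟨v, hv⟩ := h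
  have hN := eisensteinForm_mul (eisensteinConj w) z
  rw [eisensteinForm_conj, hw, hz] at hN
  have h1 : p ∣ (eisensteinMul (eisensteinConj w) z).1 := by
    refine hp.dvd_of_dvd_pow (n := 2) ⟨p * n - (eisensteinMul (eisensteinConj w) z).1 * v -
      (eisensteinMul (eisensteinConj w) z).2 * v, ?_⟩
    rw [eisensteinForm] at hN
    rw [hv] at hN ⊢
    linear_combination hN
  obtain ⟨u, hu⟩ := h1
  have he : eisensteinMul (eisensteinConj w) z = (p * u, p * v) := Prod.ext hu hv
  have key := eisensteinMul_conj_mul w z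
  rw [he, hw] at key
  have hwz : eisensteinMul w (u, v) = z := by
    simp only [eisensteinMul, Prod.mk.injEq] at key
    refine Prod.ext (mul_left_cancel₀ hp.ne_zero ?_) (mul_left_cancel₀ hp.ne_zero ?_)
    · rw [← key.1, eisensteinMul]; ring
    · rw [← key.2, eisensteinMul]; ring
  refine ⟨(u, v), ?_, hwz⟩
  rw [← hwz, eisensteinForm_mul, hw] at hz
  exact mul_left_cancel₀ hp.ne_zero hz

theorem eisensteinReps_mul_eq_union {p : ℤ} (hp : Prime p) {w : ℤ × ℤ}
    (hw : eisensteinForm w = p) (n : ℤ) :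
    eisensteinReps (p * n) = eisensteinMul w '' eisensteinReps n ∪
      eisensteinMul (eisensteinConj w) '' eisensteinReps n := by
  ext z
  constructor
  · intro hz
    -- The product of the second coordinates of `w̄ z` and `w z` is a combination of the norms of
    -- `w` and `z`. This takes the place of unique factorization.
    have hd : p ∣ (eisensteinMul (eisensteinConj w) z).2 *
        (eisensteinMul (eisensteinConj (eisensteinConj w)) z).2 := by
      have h1 : (eisensteinMul (eisensteinConj w) z).2 *
        (eisensteinMul (eisensteinConj (eisensteinConj w)) z).2 =
          z.2 ^ 2 * eisensteinForm w - w.2 ^ 2 * eisensteinForm z := by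
        simp only [eisensteinMul, eisensteinConj, eisensteinForm]; ring
      rw [h1, hw, show eisensteinForm z = p * n from hz]
      exact ⟨z.2 ^ 2 - w.2 ^ 2 * n, by ring⟩
    rcases hp.dvd_or_dvd hd with h | h
    · exact Or.inl (mem_image_eisensteinMul hp hw hz h)
    · exact Or.inr (mem_image_eisensteinMul hp ((eisensteinForm_conj w).trans hw) hz h)
  · rintro (⟨v, hv, rfl⟩ | ⟨v, hv, rfl⟩)
    · rw [eisensteinReps, Set.mem_ofPred_eq, eisensteinForm_mul, hw, hv]
    · rw [eisensteinReps, Set.mem_ofPred_eq, eisensteinForm_mul, eisensteinForm_conj, hw, hv]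

/-- The number of representations of `n / p`, which is `0` unless `p ∣ n`. -/
theorem ncard_scaled_eisensteinReps {p : ℕ} (hp : p ≠ 0) (n : ℕ) :
    {z : ℤ × ℤ | (p : ℤ) * eisensteinForm z = n}.ncard =
      if p ∣ n then (eisensteinReps (n / p : ℕ)).ncard else 0 := by
  have hp' : (p : ℤ) ≠ 0 := by exact_mod_cast hp
  split_ifs with h
  · obtain ⟨m, rfl⟩ := h
    rw [Nat.mul_div_cancel_left _ (Nat.pos_of_ne_zero hp)]
    congr 1
    ext z
    rw [eisensteinReps, Set.mem_ofPred_eq, Set.mem_ofPred_eq, Nat.cast_mul]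
    exact ⟨fun h => mul_left_cancel₀ hp' h, fun h => by rw [h]⟩
  · rw [Set.ncard_eq_zero ((finite_eisensteinForm_le n).subset ?_)]
    · refine Set.eq_empty_of_forall_notMem fun z hz => h ?_
      exact Int.natCast_dvd_natCast.1 (Dvd.intro _ hz)
    · intro z hz
      have h1 : (1 : ℤ) ≤ p := by omega
      have : (p : ℤ) * eisensteinForm z = n := hz
      have h2 := eisensteinForm_nonneg z
      show eisensteinForm z ≤ n
      nlinarith

theorem scalar_injective {c : ℤ} (hc : c ≠ 0) :
    Function.Injective fun z : ℤ × ℤ => (c * z.1, c * z.2) := by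
  intro z z' h
  simp only [Prod.mk.injEq] at h
  exact Prod.ext (mul_left_cancel₀ hc h.1) (mul_left_cancel₀ hc h.2)

theorem mem_image_scalar {p n : ℤ} (hp : p ≠ 0) {z : ℤ × ℤ} (hz : eisensteinForm z = p * n)
    (h1 : p ∣ z.1) (h2 : p ∣ z.2) :
    z ∈ (fun z : ℤ × ℤ => (p * z.1, p * z.2)) '' {z | p * eisensteinForm z = n} := by
  obtain ⟨u, hu⟩ := h1
  obtain ⟨v, hv⟩ := h2
  refine ⟨(u, v), ?_, Prod.ext hu.symm hv.symm⟩
  have hz' : z = (p * u, p * v) := Prod.ext hu hv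
  rw [hz', eisensteinForm_scalar p (u, v)] at hz
  exact mul_left_cancel₀ hp (by linear_combination hz)

/-- Inclusion–exclusion on the multiples of `w` and of `w̄`: an element divisible by both is
divisible by `p`. -/
theorem ncard_eisensteinReps_mul_split {p : ℕ} (hp : p.Prime) (hp3 : p ≠ 3) {w : ℤ × ℤ}
    (hw : eisensteinForm w = p) (n : ℕ) :
    (eisensteinReps (p * n)).ncard + {z : ℤ × ℤ | (p : ℤ) * eisensteinForm z = n}.ncard =
      2 * (eisensteinReps n).ncard := by
  have hpz : Prime (p : ℤ) := Nat.prime_iff_prime_int.1 hp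
  have hw0 : eisensteinForm w ≠ 0 := hw ▸ hpz.ne_zero
  have hc : eisensteinForm (eisensteinConj w) = p := (eisensteinForm_conj w).trans hw
  have hc0 : eisensteinForm (eisensteinConj w) ≠ 0 := hc ▸ hpz.ne_zero
  have hint : eisensteinMul w '' eisensteinReps n ∩
      eisensteinMul (eisensteinConj w) '' eisensteinReps n =
      (fun z : ℤ × ℤ => ((p : ℤ) * z.1, (p : ℤ) * z.2)) ''
        {z | (p : ℤ) * eisensteinForm z = n} := by
    ext z
    constructor
    · rintro ⟨⟨u, hu, rfl⟩, v, hv, huv⟩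
      have hz : eisensteinForm (eisensteinMul w u) = p * n := by
        rw [eisensteinForm_mul, hw, hu]
      have e1 := congrArg Prod.snd (eisensteinMul_mul_conj w u)
      have e2 := congrArg Prod.snd (eisensteinMul_conj_mul w v)
      rw [huv] at e2
      -- Since `(2 w₁ + w₂)² = 4p - 3 w₂²`, this is where `p ≠ 3` enters.
      have hw3 : ¬ (p : ℤ) ∣ w.2 ∧ ¬ (p : ℤ) ∣ 2 * w.1 + w.2 := by
        have hnot : ¬ (p : ℤ) ∣ w.2 := by
          intro h
          have h1 : (p : ℤ) ∣ w.1 := by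
            refine hpz.dvd_of_dvd_pow (n := 2) ?_
            have : w.1 ^ 2 = eisensteinForm w - w.2 * (w.1 + w.2) := by rw [eisensteinForm]; ring
            rw [this, hw]
            exact dvd_sub dvd_rfl (h.mul_right _)
          obtain ⟨a, ha⟩ := h1
          obtain ⟨b, hb⟩ := h
          have hw' : w = (p * a, p * b) := Prod.ext ha hb
          rw [hw', eisensteinForm_scalar p (a, b)] at hw
          exact hpz.not_dvd_one ⟨eisensteinForm (a, b),
            mul_left_cancel₀ hpz.ne_zero (by linear_combination -hw)⟩
        refine ⟨hnot, fun h => ?_⟩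
        have h3 : (p : ℤ) ∣ 3 * w.2 ^ 2 := by
          have : 3 * w.2 ^ 2 = 4 * eisensteinForm w - (2 * w.1 + w.2) ^ 2 := by
            rw [four_mul_eisensteinForm]; ring
          rw [this, hw]
          exact dvd_sub (Dvd.intro_left _ rfl) (h.trans (Dvd.intro_left _ (sq _).symm))
        rcases hpz.dvd_or_dvd h3 with h3 | h3
        · have h3' : p ∣ 3 := by exact_mod_cast h3
          exact hp3 ((Nat.prime_dvd_prime_iff_eq hp Nat.prime_three).1 h3')
        · exact hnot (hpz.dvd_of_dvd_pow h3)
      generalize eisensteinMul w u = z at hz e1 e2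
      simp only [eisensteinMul, eisensteinConj, hw] at e1 e2
      -- Adding the second coordinates of `w̄ z = p u` and `w z = p v` leaves `(2 w₁ + w₂) z₂`.
      have d2 : (p : ℤ) ∣ z.2 := by
        refine (hpz.dvd_or_dvd (a := 2 * w.1 + w.2) ?_).resolve_left hw3.2
        exact ⟨u.2 + v.2, by linear_combination e1 + e2⟩
      refine mem_image_scalar hpz.ne_zero hz ?_ d2
      refine (hpz.dvd_or_dvd (a := w.2) ?_).resolve_left hw3.1
      obtain ⟨t, ht⟩ := d2
      exact ⟨v.2 - w.1 * t - w.2 * t, by linear_combination e2 - (w.1 + w.2) * ht⟩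
    · rintro ⟨u, hu, rfl⟩
      have hu' : (p : ℤ) * eisensteinForm u = n := hu
      refine ⟨⟨eisensteinMul (eisensteinConj w) u, ?_, ?_⟩, eisensteinMul w u, ?_, ?_⟩
      · rw [eisensteinReps, Set.mem_ofPred_eq, eisensteinForm_mul, hc, hu']
      · rw [eisensteinMul_conj_mul, hw]
      · rw [eisensteinReps, Set.mem_ofPred_eq, eisensteinForm_mul, hw, hu']
      · rw [eisensteinMul_mul_conj, hw]
  have hfin := finite_eisensteinReps n
  have := Set.ncard_union_add_ncard_inter _ _ (hfin.image (eisensteinMul w))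
    (hfin.image (eisensteinMul (eisensteinConj w)))
  rw [hint, ← eisensteinReps_mul_eq_union hpz hw,
    Set.ncard_image_of_injective _ (eisensteinMul_injective hw0),
    Set.ncard_image_of_injective _ (eisensteinMul_injective hc0),
    Set.ncard_image_of_injective _ (scalar_injective hpz.ne_zero)] at this
  omega

theorem ncard_eisensteinReps_three_mul (n : ℕ) :
    (eisensteinReps (3 * n)).ncard = (eisensteinReps n).ncard := by
  have hw : eisensteinForm (1, 1) = 3 := rfl
  have h : eisensteinMul (eisensteinConj (1, 1)) '' eisensteinReps n =
      eisensteinMul (1, 1) '' eisensteinReps n := by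
    ext z
    constructor
    · rintro ⟨⟨x, y⟩, hz, rfl⟩
      -- This is `ω̄ (x + y ω)`: 3 ramifies, with `1 + ω̄ = ω̄ (1 + ω)`. The converse uses the unit
      -- `ω`.
      refine ⟨(x + y, -x), ?_, ?_⟩
      · rw [eisensteinReps, Set.mem_ofPred_eq, ← show eisensteinForm (x, y) = n from hz]
        simp only [eisensteinForm]; ring
      · simp only [eisensteinMul, eisensteinConj, Prod.mk.injEq]
        constructor <;> ring
    · rintro ⟨⟨x, y⟩, hz, rfl⟩
      refine ⟨(-y, x + y), ?_, ?_⟩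
      · rw [eisensteinReps, Set.mem_ofPred_eq, ← show eisensteinForm (x, y) = n from hz]
        simp only [eisensteinForm]; ring
      · simp only [eisensteinMul, eisensteinConj, Prod.mk.injEq]
        constructor <;> ring
  rw [eisensteinReps_mul_eq_union Int.prime_three hw, h, Set.union_self,
    Set.ncard_image_of_injective _ (eisensteinMul_injective (by rw [hw]; norm_num))]

/-- A zero of the form modulo `p` satisfies `x³ = y³`. As 3 does not divide `p - 1`, cubing is
injective on units, so `x = y` and `3 x² = 0`. -/
theorem dvd_of_dvd_eisensteinForm {p : ℕ} [Fact p.Prime] (h3 : p % 3 = 2) {z : ℤ × ℤ}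
    (h : (p : ℤ) ∣ eisensteinForm z) : (p : ℤ) ∣ z.1 ∧ (p : ℤ) ∣ z.2 := by
  have h0 : ((eisensteinForm z : ℤ) : ZMod p) = 0 := (ZMod.intCast_zmod_eq_zero_iff_dvd _ p).2 h
  rw [eisensteinForm] at h0
  push_cast at h0
  rw [← ZMod.intCast_zmod_eq_zero_iff_dvd, ← ZMod.intCast_zmod_eq_zero_iff_dvd]
  generalize (z.1 : ZMod p) = x at h0
  generalize (z.2 : ZMod p) = y at h0
  by_cases hy : y = 0
  · subst hy
    exact ⟨by simpa using h0, rfl⟩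
  by_cases hx : x = 0
  · subst hx
    exact ⟨rfl, by simpa using h0⟩
  exfalso
  obtain ⟨k, hk⟩ : ∃ k, p - 1 = 3 * k + 1 := ⟨p / 3, by omega⟩
  have hcube : x ^ 3 = y ^ 3 := by linear_combination (x - y) * h0
  have e1 := ZMod.pow_card_sub_one_eq_one hx
  have e2 := ZMod.pow_card_sub_one_eq_one hy
  rw [hk, pow_succ, pow_mul, hcube] at e1
  rw [hk, pow_succ, pow_mul] at e2
  have hxy : x = y := mul_left_cancel₀ (pow_ne_zero k (pow_ne_zero 3 hy)) (e1.trans e2.symm)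
  subst hxy
  have h3x : ((3 : ℕ) : ZMod p) = 0 := by
    refine (mul_eq_zero.1 (?_ : ((3 : ℕ) : ZMod p) * x ^ 2 = 0)).resolve_right (pow_ne_zero 2 hx)
    push_cast
    linear_combination h0
  rw [ZMod.natCast_eq_zero_iff, Nat.prime_dvd_prime_iff_eq Fact.out Nat.prime_three] at h3x
  omega

theorem ncard_eisensteinReps_mul_inert {p : ℕ} [Fact p.Prime] (h3 : p % 3 = 2) (n : ℕ) :
    (eisensteinReps (p * n)).ncard = {z : ℤ × ℤ | (p : ℤ) * eisensteinForm z = n}.ncard := by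
  have hp0 : (p : ℤ) ≠ 0 := by exact_mod_cast (Fact.out : p.Prime).ne_zero
  rw [← Set.ncard_image_of_injective {z : ℤ × ℤ | (p : ℤ) * eisensteinForm z = n}
    (scalar_injective hp0)]
  congr 1
  ext z
  constructor
  · intro hz
    obtain ⟨h1, h2⟩ := dvd_of_dvd_eisensteinForm h3 (Dvd.intro _ (Eq.symm hz))
    exact mem_image_scalar hp0 hz h1 h2
  · rintro ⟨u, hu, rfl⟩
    rw [eisensteinReps, Set.mem_ofPred_eq, eisensteinForm_scalar,
      ← show (p : ℤ) * eisensteinForm u = n from hu]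
    ring

/-- Thue's argument: with `t` a primitive cube root of unity modulo `p`, the pigeonhole principle
gives a small nonzero `(a, b)` with `a ≡ t b`. Its norm is a multiple of `p` below `3p`. -/
theorem exists_eisensteinForm_eq {p : ℕ} [hp : Fact p.Prime] (h3 : p % 3 = 1) :
    ∃ w, eisensteinForm w = p := by
  obtain ⟨t, ht⟩ : ∃ t : ZMod p, t ^ 2 + t + 1 = 0 := by
    have hcard : 3 ∣ Fintype.card (ZMod p)ˣ := by
      rw [ZMod.card_units]
      omega
    obtain ⟨u, hu⟩ := exists_prime_orderOf_dvd_card 3 hcard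
    have hu1 : (u : ZMod p) - 1 ≠ 0 := by
      rw [sub_ne_zero, ne_eq, Units.val_eq_one]
      rintro rfl
      simp at hu
    have hu3 : (u : ZMod p) ^ 3 = 1 := by
      rw [← Units.val_pow_eq_pow_val, ← hu, pow_orderOf_eq_one, Units.val_one]
    exact ⟨u, mul_left_cancel₀ hu1 (by linear_combination hu3)⟩
  set s := p.sqrt
  have hs : s * s < p := (Nat.sqrt_le p).lt_of_ne fun h =>
    (Nat.Prime.prime hp.out).irreducible.not_isSquare ⟨s, h.symm⟩
  obtain ⟨u, hu, v, hv, huv, he⟩ := Finset.exists_ne_map_eq_of_card_lt_of_maps_to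
    (s := Finset.range (s + 1) ×ˢ Finset.range (s + 1)) (t := (Finset.univ : Finset (ZMod p)))
    (f := fun u => (u.1 : ZMod p) - t * u.2)
    (by
      rw [Finset.card_univ, ZMod.card, Finset.card_product, Finset.card_range]
      exact Nat.lt_succ_sqrt p) (fun _ _ => Finset.mem_coe.2 (Finset.mem_univ _))
  simp only [Finset.mem_product, Finset.mem_range] at hu hv he
  obtain ⟨a, ha⟩ : ∃ a : ℤ, a = u.1 - v.1 := ⟨_, rfl⟩
  obtain ⟨b, hb⟩ : ∃ b : ℤ, b = u.2 - v.2 := ⟨_, rfl⟩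
  have hdvd : (p : ℤ) ∣ eisensteinForm (a, b) := by
    rw [← ZMod.intCast_zmod_eq_zero_iff_dvd, eisensteinForm, ha, hb]
    push_cast
    have e : (u.1 : ZMod p) - v.1 = t * (u.2 - v.2) := by linear_combination he
    rw [e]
    linear_combination ((u.2 : ZMod p) - v.2) ^ 2 * ht
  have hpos : 0 < eisensteinForm (a, b) := by
    refine (eisensteinForm_nonneg _).lt_of_ne fun h => huv ?_
    have := eisensteinForm_eq_zero.1 h.symm
    simp only [Prod.mk_eq_zero] at this
    exact Prod.ext (by omega) (by omega)
  have hlt : eisensteinForm (a, b) < 3 * p := by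
    have ha2 : a ^ 2 ≤ s ^ 2 := sq_le_sq' (by omega) (by omega)
    have hb2 : b ^ 2 ≤ s ^ 2 := sq_le_sq' (by omega) (by omega)
    have hs' : (s : ℤ) ^ 2 < p := by rw [sq]; exact_mod_cast hs
    simp only [eisensteinForm]
    nlinarith [sq_nonneg (a - b)]
  obtain ⟨c, hc⟩ := hdvd
  have hp0 : (0 : ℤ) < p := by exact_mod_cast hp.out.pos
  have hc1 : 0 < c := by
    rw [hc] at hpos
    exact pos_of_mul_pos_right hpos hp0.le
  have hc2 : c < 3 := by
    rw [hc, mul_comm] at hlt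
    exact lt_of_mul_lt_mul_right hlt hp0.le
  obtain rfl | rfl : c = 1 ∨ c = 2 := by omega
  · exact ⟨(a, b), by rw [hc, mul_one]⟩
  · exfalso
    -- A norm of `2p` is even, which forces `a` and `b` even and the norm divisible by 4. Then `p =
    -- 2`, contrary to `p ≡ 1` modulo 3.
    have hpar : Even a ∧ Even b := by
      have : Even (eisensteinForm (a, b)) := ⟨p, by rw [hc]; ring⟩
      simp only [eisensteinForm, Int.even_add, Int.even_mul, Int.even_pow] at this
      tauto
    obtain ⟨⟨a', rfl⟩, b', rfl⟩ := hpar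
    simp only [eisensteinForm] at hc
    have h2 : 2 ∣ p := by
      have : (2 : ℤ) ∣ p := ⟨a' ^ 2 + a' * b' + b' ^ 2,
        mul_right_cancel₀ two_ne_zero (by linear_combination -hc)⟩
      exact_mod_cast this
    rw [Nat.prime_dvd_prime_iff_eq Nat.prime_two hp.out] at h2
    omega

/-! ### The common recursion and the representation count -/

theorem chiThree_mul (m n : ℕ) : chiThree (m * n) = chiThree m * chiThree n := by
  have hm : m % 3 = 0 ∨ m % 3 = 1 ∨ m % 3 = 2 := by omega
  have hn : n % 3 = 0 ∨ n % 3 = 1 ∨ n % 3 = 2 := by omega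
  simp only [chiThree, Nat.mul_mod m n]
  rcases hm with h | h | h <;> rcases hn with h' | h' | h' <;> simp [h, h']

/-- The divisors of `p n` are those of `n` together with their multiples by `p`; the overlap is `p`
times the divisors of `n / p`. -/
theorem divisorSumChiThree_prime_mul {p n : ℕ} (hp : p.Prime) (hn : n ≠ 0) :
    divisorSumChiThree (p * n) + chiThree p * (if p ∣ n then divisorSumChiThree (n / p) else 0) =
      (1 + chiThree p) * divisorSumChiThree n := by
  have hinj : Function.Injective (p * ·) := mul_right_injective₀ hp.ne_zero
  have himg : ∀ s : Finset ℕ, ∑ d ∈ s.image (p * ·), chiThree d =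
      chiThree p * ∑ d ∈ s, chiThree d := fun s => by
    rw [Finset.sum_image hinj.injOn, Finset.mul_sum]
    exact Finset.sum_congr rfl fun d _ => chiThree_mul p d
  have hunion : (p * n).divisors = n.divisors ∪ n.divisors.image (p * ·) := by
    ext d
    simp only [Nat.mem_divisors, Finset.mem_union, Finset.mem_image]
    constructor
    · rintro ⟨h, -⟩
      by_cases hd : p ∣ d
      · obtain ⟨e, rfl⟩ := hd
        exact Or.inr ⟨e, ⟨Nat.dvd_of_mul_dvd_mul_left hp.pos h, hn⟩, rfl⟩
      · exact Or.inl ⟨((hp.coprime_iff_not_dvd.2 hd).symm).dvd_of_dvd_mul_left h, hn⟩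
    · rintro (⟨h, -⟩ | ⟨e, ⟨h, -⟩, rfl⟩)
      · exact ⟨h.mul_left p, mul_ne_zero hp.ne_zero hn⟩
      · exact ⟨Nat.mul_dvd_mul_left p h, mul_ne_zero hp.ne_zero hn⟩
  have hinter : ∑ d ∈ n.divisors ∩ n.divisors.image (p * ·), chiThree d =
      chiThree p * (if p ∣ n then divisorSumChiThree (n / p) else 0) := by
    split_ifs with h
    · obtain ⟨m, rfl⟩ := h
      rw [Nat.mul_div_cancel_left _ hp.pos, divisorSumChiThree, ← himg]
      refine Finset.sum_congr ?_ fun _ _ => rfl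
      ext d
      simp only [Nat.mem_divisors, Finset.mem_inter, Finset.mem_image]
      constructor
      · rintro ⟨⟨h, -⟩, e, -, rfl⟩
        exact ⟨e, ⟨Nat.dvd_of_mul_dvd_mul_left hp.pos h, right_ne_zero_of_mul hn⟩, rfl⟩
      · rintro ⟨e, ⟨h, -⟩, rfl⟩
        exact ⟨⟨Nat.mul_dvd_mul_left p h, hn⟩, e, ⟨h.mul_left p, hn⟩, rfl⟩
    · rw [mul_zero]
      refine Finset.sum_eq_zero fun d hd => absurd ?_ h
      simp only [Nat.mem_divisors, Finset.mem_inter, Finset.mem_image] at hd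
      obtain ⟨⟨h, -⟩, e, -, rfl⟩ := hd
      exact (Dvd.intro _ rfl).trans h
  have := Finset.sum_union_inter (s₁ := n.divisors) (s₂ := n.divisors.image (p * ·)) (f := chiThree)
  rw [← hunion, hinter, himg] at this
  rw [divisorSumChiThree, this, divisorSumChiThree]
  ring

theorem ncard_eisensteinReps_prime_mul {p : ℕ} (hp : p.Prime) (n : ℕ) :
    ((eisensteinReps (p * n : ℕ)).ncard : ℤ) +
      chiThree p * (if p ∣ n then ((eisensteinReps (n / p : ℕ)).ncard : ℤ) else 0) =
      (1 + chiThree p) * (eisensteinReps n).ncard := by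
  have : Fact p.Prime := ⟨hp⟩
  have hs := ncard_scaled_eisensteinReps hp.ne_zero n
  rw [Nat.cast_mul]
  obtain h | h | h : p % 3 = 0 ∨ p % 3 = 1 ∨ p % 3 = 2 := by omega
  · obtain rfl := (Nat.prime_dvd_prime_iff_eq Nat.prime_three hp).1 (Nat.dvd_of_mod_eq_zero h)
    rw [Nat.cast_ofNat, ncard_eisensteinReps_three_mul]
    simp [chiThree]
  · obtain ⟨w, hw⟩ := exists_eisensteinForm_eq h
    have := ncard_eisensteinReps_mul_split hp (by rintro rfl; simp at h) hw n
    rw [hs] at this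
    simp only [chiThree, h, if_true]
    split_ifs at this ⊢ <;> omega
  · have := ncard_eisensteinReps_mul_inert h n
    rw [hs] at this
    rw [this]
    have hchi : chiThree p = -1 := by simp [chiThree, h]
    rw [hchi]
    split_ifs <;> simp

theorem ncard_eisensteinReps_one : (eisensteinReps 1).ncard = 6 := by
  have : eisensteinReps 1 =
      (({(1, 0), (-1, 0), (0, 1), (0, -1), (1, -1), (-1, 1)} : Finset (ℤ × ℤ)) : Set (ℤ × ℤ)) := by
    ext ⟨x, y⟩
    constructor
    · intro h
      have h : x ^ 2 + x * y + y ^ 2 = 1 := h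
      have hx1 : x ≤ 1 := by nlinarith [sq_nonneg (x + 2 * y)]
      have hx2 : -1 ≤ x := by nlinarith [sq_nonneg (x + 2 * y)]
      have hy1 : y ≤ 1 := by nlinarith [sq_nonneg (2 * x + y)]
      have hy2 : -1 ≤ y := by nlinarith [sq_nonneg (2 * x + y)]
      interval_cases x <;> interval_cases y <;> simp at h ⊢
    · intro h
      simp only [Finset.coe_insert, Finset.coe_singleton, Set.mem_insert_iff,
        Set.mem_singleton_iff, Prod.mk.injEq] at h
      rcases h with ⟨rfl, rfl⟩ | ⟨rfl, rfl⟩ | ⟨rfl, rfl⟩ | ⟨rfl, rfl⟩ | ⟨rfl, rfl⟩ | ⟨rfl, rfl⟩ <;> rfl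
  rw [this, Set.ncard_coe_finset]
  rfl

/-- The number of representations of `n` by `x² + x y + y²` is `6 ∑_{d ∣ n} χ(d)`. -/
theorem ncard_eisensteinReps (n : ℕ) (hn : n ≠ 0) :
    ((eisensteinReps n).ncard : ℤ) = 6 * divisorSumChiThree n := by
  induction n using Nat.strong_induction_on with
  | _ n ih =>
    by_cases h1 : n = 1
    · subst h1
      rw [Nat.cast_one, ncard_eisensteinReps_one]
      simp [divisorSumChiThree, chiThree]
    obtain ⟨p, hp, m, rfl⟩ := Nat.exists_prime_and_dvd h1
    have hm : m ≠ 0 := right_ne_zero_of_mul hn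
    have e1 := ncard_eisensteinReps_prime_mul hp m
    have e2 := divisorSumChiThree_prime_mul hp hm
    have hlt : m < p * m := lt_mul_of_one_lt_left (Nat.pos_of_ne_zero hm) hp.one_lt
    rw [ih m hlt hm] at e1
    split_ifs at e1 e2 with hd
    · rw [ih (m / p) ((Nat.div_le_self m p).trans_lt hlt)
        (Nat.div_pos (Nat.le_of_dvd (Nat.pos_of_ne_zero hm) hd) hp.pos).ne'] at e1
      linear_combination e1 - 6 * e2
    · linear_combination e1 - 6 * e2

/-! ### Generating series and convergence -/

theorem sigmaRat_natCast (k n : ℕ) (hn : n ≠ 0) :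
    sigmaRat k n = ∑ d ∈ n.divisors, d ^ k := by
  rw [sigmaRat, if_pos ⟨Rat.den_natCast n, by rw [Rat.num_natCast]; omega⟩, Rat.num_natCast,
    Int.toNat_natCast]

theorem sigmaRat_natCast_div_three (n : ℕ) (hn : n ≠ 0) :
    (sigmaRat 1 ((n : ℚ) / 3) : ℤ) = sigmaThird n := by
  rw [sigmaThird]
  split_ifs with h
  · obtain ⟨m, rfl⟩ := h
    rw [show ((3 * m : ℕ) : ℚ) / 3 = m by push_cast; ring,
      sigmaRat_natCast _ _ (right_ne_zero_of_mul hn), Nat.mul_div_cancel_left _ (by norm_num)]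
    simp
  · rw [sigmaRat, if_neg, Nat.cast_zero]
    rintro ⟨hden, -⟩
    have h1 : (((n : ℚ) / 3).num : ℚ) = (n : ℚ) / 3 := Rat.den_eq_one_iff _ |>.1 hden
    have h2 : (((n : ℚ) / 3).num * 3 : ℚ) = n := by rw [h1]; ring
    have h3 : ((n : ℚ) / 3).num * 3 = n := by exact_mod_cast h2
    exact h (by omega)

/-- The coefficient of `q ^ n` in `a(q)`. -/
def cubicThetaCoeff (n : ℕ) : ℤ := (if n = 0 then 1 else 0) + 6 * divisorSumChiThree n

theorem ncard_eisensteinReps_eq_cubicThetaCoeff (n : ℕ) :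
    ((eisensteinReps n).ncard : ℤ) = cubicThetaCoeff n := by
  rcases eq_or_ne n 0 with rfl | hn
  · have : eisensteinReps (0 : ℕ) = {0} := by
      ext z
      exact eisensteinForm_eq_zero
    rw [this, Set.ncard_singleton]
    simp [cubicThetaCoeff, divisorSumChiThree]
  · rw [ncard_eisensteinReps n hn, cubicThetaCoeff, if_neg hn, zero_add]

theorem abs_divisorSumChiThree_le (n : ℕ) : |divisorSumChiThree n| ≤ n := by
  refine (Finset.abs_sum_le_sum_abs _ _).trans ?_
  have h : ∀ d ∈ n.divisors, |chiThree d| ≤ 1 := fun d _ => by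
    unfold chiThree
    split_ifs <;> simp
  refine (Finset.sum_le_card_nsmul _ _ 1 h).trans ?_
  rw [nsmul_eq_mul, mul_one]
  exact_mod_cast Nat.card_divisors_le_self n

theorem summable_norm_cubicThetaCoeff {q : ℂ} (hq : ‖q‖ < 1) :
    Summable fun n : ℕ => ‖(cubicThetaCoeff n : ℂ) * q ^ n‖ := by
  have h0 : Summable fun n : ℕ => ‖q‖ ^ n := summable_geometric_of_lt_one (norm_nonneg _) hq
  have h1 : Summable fun n : ℕ => (n : ℝ) ^ 1 * ‖q‖ ^ n :=
    summable_pow_mul_geometric_of_norm_lt_one 1 (by rwa [norm_norm])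
  refine Summable.of_nonneg_of_le (fun _ => norm_nonneg _) (fun n => ?_) (h0.add (h1.mul_left 6))
  rw [norm_mul, norm_pow, Complex.norm_intCast, ← Int.cast_abs, pow_one]
  have hb : |cubicThetaCoeff n| ≤ 1 + 6 * n := by
    have := abs_le.1 (abs_divisorSumChiThree_le n)
    rw [cubicThetaCoeff, abs_le]
    split_ifs <;> constructor <;> linarith
  have hb' : ((|cubicThetaCoeff n| : ℤ) : ℝ) ≤ 1 + 6 * n := by exact_mod_cast hb
  calc ((|cubicThetaCoeff n| : ℤ) : ℝ) * ‖q‖ ^ n ≤ (1 + 6 * n) * ‖q‖ ^ n := by gcongr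
    _ = ‖q‖ ^ n + 6 * (n * ‖q‖ ^ n) := by ring

theorem sum_antidiagonal_cubicThetaCoeff (n : ℕ) (hn : n ≠ 0) :
    ∑ k ∈ Finset.HasAntidiagonal.antidiagonal n, cubicThetaCoeff k.1 * cubicThetaCoeff k.2 =
      12 * (∑ d ∈ n.divisors, (d : ℤ) - 3 * sigmaThird n) := by
  have hA : PowerSeries.mk cubicThetaCoeff =
      1 + PowerSeries.C 6 * PowerSeries.mk divisorSumChiThree := by
    ext m
    rw [map_add, PowerSeries.coeff_C_mul, PowerSeries.coeff_mk, PowerSeries.coeff_mk,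
      PowerSeries.coeff_one, cubicThetaCoeff]
  have hsq : PowerSeries.mk cubicThetaCoeff * PowerSeries.mk cubicThetaCoeff =
      1 + PowerSeries.C 12 * PowerSeries.mk divisorSumChiThree + PowerSeries.C 36 *
        (PowerSeries.mk divisorSumChiThree * PowerSeries.mk divisorSumChiThree) := by
    rw [hA, show (12 : ℤ) = 6 + 6 by norm_num, show (36 : ℤ) = 6 * 6 by norm_num, map_add, map_mul]
    ring
  have h := congrArg (PowerSeries.coeff n) hsq
  rw [map_add, map_add, PowerSeries.coeff_C_mul, PowerSeries.coeff_C_mul, PowerSeries.coeff_one,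
    if_neg hn, PowerSeries.coeff_mul, PowerSeries.coeff_mul] at h
  simp only [PowerSeries.coeff_mk] at h
  linear_combination h + 12 * sum_antidiagonal_divisorSumChiThree n

theorem toNat_eisensteinForm_eq_iff (z : ℤ × ℤ) (n : ℕ) :
    (eisensteinForm z).toNat = n ↔ z ∈ eisensteinReps n := by
  have := eisensteinForm_nonneg z
  rw [eisensteinReps, Set.mem_ofPred_eq]
  omega

theorem cubicThetaTerm_eq_pow (q : ℂ) (z : ℤ × ℤ) :
    cubicThetaTerm q z = q ^ (eisensteinForm z).toNat := by
  rw [← zpow_natCast, Int.toNat_of_nonneg (eisensteinForm_nonneg z)]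
  rfl

/-- Stated over any normed field so as to serve both `q` and, for absolute convergence, `‖q‖`. -/
theorem hasSum_fiber_eisensteinForm {E : Type*} [NormedField E] (q : E) (n : ℕ) :
    HasSum (fun z : {z : ℤ × ℤ // (eisensteinForm z).toNat = n} =>
      q ^ (eisensteinForm z).toNat) ((cubicThetaCoeff n : E) * q ^ n) := by
  have e : {z : ℤ × ℤ | (eisensteinForm z).toNat = n} = eisensteinReps n := by
    ext z
    exact toNat_eisensteinForm_eq_iff z n
  have hfin : {z : ℤ × ℤ | (eisensteinForm z).toNat = n}.Finite := by
    rw [e]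
    exact finite_eisensteinReps n
  have : Finite {z : ℤ × ℤ // (eisensteinForm z).toNat = n} := hfin.to_subtype
  have hcard : Nat.card {z : ℤ × ℤ // (eisensteinForm z).toNat = n} = (eisensteinReps n).ncard := by
    rw [← e]
    rfl
  have := Fintype.ofFinite {z : ℤ × ℤ // (eisensteinForm z).toNat = n}
  have h := hasSum_fintype fun z : {z : ℤ × ℤ // (eisensteinForm z).toNat = n} =>
      q ^ (eisensteinForm z).toNat
  rw [Finset.sum_congr rfl fun z _ => by rw [z.2], Finset.sum_const, Finset.card_univ,
    ← Nat.card_eq_fintype_card, hcard, nsmul_eq_mul, ← Int.cast_natCast,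
    ncard_eisensteinReps_eq_cubicThetaCoeff] at h
  exact h

theorem summable_norm_cubicThetaTerm {q : ℂ} (hq : ‖q‖ < 1) :
    Summable fun z : ℤ × ℤ => ‖cubicThetaTerm q z‖ := by
  simp only [cubicThetaTerm_eq_pow, norm_pow]
  rw [← (Equiv.sigmaFiberEquiv fun z => (eisensteinForm z).toNat).summable_iff]
  refine (summable_sigma_of_nonneg fun _ => pow_nonneg (norm_nonneg q) _).2
    ⟨fun n => (hasSum_fiber_eisensteinForm ‖q‖ n).summable, ?_⟩
  refine (summable_norm_cubicThetaCoeff hq).congr fun n => ?_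
  refine Eq.trans ?_ (hasSum_fiber_eisensteinForm ‖q‖ n).tsum_eq.symm
  -- The coefficients count representations, hence are nonnegative and equal their absolute values.
  rw [norm_mul, norm_pow, Complex.norm_intCast, abs_of_nonneg]
  rw [← ncard_eisensteinReps_eq_cubicThetaCoeff]
  positivity

theorem cubicThetaA_eq_tsum {q : ℂ} (hq : ‖q‖ < 1) :
    cubicThetaA q = ∑' n : ℕ, (cubicThetaCoeff n : ℂ) * q ^ n := by
  have hs := (summable_norm_cubicThetaTerm hq).of_norm
  have hf : ∀ n, HasSum (fun z : {z : ℤ × ℤ // (eisensteinForm z).toNat = n} =>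
      cubicThetaTerm q z) ((cubicThetaCoeff n : ℂ) * q ^ n) := fun n => by
    simp only [cubicThetaTerm_eq_pow]
    exact hasSum_fiber_eisensteinForm q n
  exact (((Equiv.sigmaFiberEquiv fun z : ℤ × ℤ => (eisensteinForm z).toNat).hasSum_iff.2
    hs.hasSum).sigma hf).tsum_eq.symm

theorem mainTheorem8 (q : ℂ) (hq : ‖q‖ < 1) :
    Summable (fun p : ℤ × ℤ => cubicThetaTerm q p) ∧
    Summable (fun n : ℕ+ =>
      ((sigmaRat 1 (n : ℚ) : ℂ) - 3 * (sigmaRat 1 ((n : ℚ) / 3) : ℂ)) * q ^ (n : ℕ)) ∧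
    cubicThetaA q ^ 2 =
      1 + 12 * ∑' n : ℕ+,
        ((sigmaRat 1 (n : ℚ) : ℂ) - 3 * (sigmaRat 1 ((n : ℚ) / 3) : ℂ)) * q ^ (n : ℕ) := by
  have hA := summable_norm_cubicThetaCoeff hq
  let c : ℕ → ℂ := fun n => ∑ k ∈ Finset.HasAntidiagonal.antidiagonal n,
    ((cubicThetaCoeff k.1 : ℂ) * q ^ k.1) * ((cubicThetaCoeff k.2 : ℂ) * q ^ k.2)
  have hc : Summable c := (summable_norm_sum_mul_antidiagonal_of_summable_norm hA hA).of_norm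
  -- The constant term is split off because the target series runs over `n ≥ 1`.
  have hc0 : c 0 = 1 := by simp [c, cubicThetaCoeff, divisorSumChiThree]
  have hterm : ∀ n : ℕ+, ((sigmaRat 1 (n : ℚ) : ℂ) - 3 * (sigmaRat 1 ((n : ℚ) / 3) : ℂ)) *
      q ^ (n : ℕ) = 12⁻¹ * c n := fun n => by
    have h1 : c n = ((∑ k ∈ Finset.HasAntidiagonal.antidiagonal (n : ℕ),
        cubicThetaCoeff k.1 * cubicThetaCoeff k.2 : ℤ) : ℂ) * q ^ (n : ℕ) := by
      rw [Int.cast_sum, Finset.sum_mul]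
      refine Finset.sum_congr rfl fun k hk => ?_
      rw [← Finset.HasAntidiagonal.mem_antidiagonal.1 hk, pow_add]
      push_cast
      ring
    have h2 := sigmaRat_natCast 1 n n.ne_zero
    have h3 := sigmaRat_natCast_div_three n n.ne_zero
    rw [h1, sum_antidiagonal_cubicThetaCoeff _ n.ne_zero, h2, ← h3]
    push_cast
    simp only [pow_one]
    ring
  refine ⟨(summable_norm_cubicThetaTerm hq).of_norm, ?_, ?_⟩
  · simp only [hterm]
    exact (hc.comp_injective PNat.coe_injective).mul_left _
  · simp only [hterm]
    rw [tsum_mul_left, mul_inv_cancel_left₀ (by norm_num), tsum_pnat_eq_tsum_succ (f := c), ← hc0,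
      ← hc.tsum_eq_zero_add, sq, cubicThetaA_eq_tsum hq,
      tsum_mul_tsum_eq_tsum_sum_antidiagonal_of_summable_norm hA hA]
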